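/- Let $P,Q_1,Q_2,Q_d\ge 0$. Consider the two-receiver memoryless channel $Y_k^n = X^n + S_k^n + Z_k^n$, $k=1,2$, where the pairs $(S_{1,i},S_{2,i})$, $i=1,\dots,n$, are i.i.d. jointly Gaussian with $S_{k,i}\sim\mathcal N(0,Q_k)$ and $S_{1,i}-S_{2,i}\sim\mathcal N(0,Q_d)$, the noise pairs $(Z_{1,i},Z_{2,i})$ are i.i.d. with $Z_{k,i}\sim\mathcal N(0,1)$ and an arbitrary joint law (for instance a common noise $Z_1^n=Z_2^n=Z^n$, or independent noises), and the message $W$, the interferences and the noises are mutually independent. The transmitter knows $(S_1^n,S_2^n)$ noncausally, the receivers do not. A code of block length $n$ with $M$ messages consists of a (measurable) encoder $X^n=f_n(W,S_1^n,S_2^n)$ and (measurable) decoders $g_{k,n}$ mapping $Y_k^n$ to a message, with $W$ uniform on the $M$ messages, and satisfies the power constraint $P$ if $\frac1n E\big[\sum_{i=1}^n X_i^2\big]\le P$, the expectation being over the message and the interferences. A rate $R\ge 0$ is achievable if there is a sequence of codes of block lengths $n$ with $\lfloor 2^{nR}\rfloor$ messages, all satisfying the power constraint $P$, such that $\Pr\big(g_{1,n}(Y_1^n)\ne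 W \text{ or } g_{2,n}(Y_2^n)\ne W\big)\to 0$ as $n\to\infty$. Then every achievable (common-message) rate $R$ satisfies $$R \;\le\; \sum_{k=1}^2 \frac14\log_2\!\left(P+Q_k+1+2\sqrt{PQ_k}\right) - T(Q_d),$$ where $$T(Q_d)=\begin{cases}\frac14\log_2 Q_d, & Q_d>4,\\[2pt] \frac12\log_2\!\left(1+\frac{Q_d}{4}\right), & Q_d\le 4.\end{cases}$$ -/

import Mathlib

open MeasureTheory ProbabilityTheory Filter Topology
open scoped NNReal ENNReal

namespace Multicast

noncomputable section

/-- A code with `M` (common) messages and block length `n` for the two-receiver multicast channel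
with real input, real outputs and state alphabet `ℝ²`. The encoder knows the message and, non-causally,
the whole state sequence `s = (s₁ⁿ, s₂ⁿ)`, where `s i k` is the interference at time `i` on the link to
receiver `k`. Decoder `k` sees only its own output sequence. -/
structure Code (M n : ℕ) where
  enc : Fin M → (Fin n → Fin 2 → ℝ) → (Fin n → ℝ)
  measurable_enc : ∀ w, Measurable (enc w)
  dec : Fin 2 → (Fin n → ℝ) → Fin M
  measurable_dec : ∀ k, Measurable (dec k)

/-- The channel output `Y_kⁿ = Xⁿ + S_kⁿ + Z_kⁿ` at receiver `k`. -/
def output {n : ℕ} (x : Fin n → ℝ) (s z : Fin n → Fin 2 → ℝ) (k : Fin 2) : Fin n → ℝ :=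
  fun i => x i + s i k + z i k

/-- The average power `(1/n) E[∑ᵢ Xᵢ²(W, S₁ⁿ, S₂ⁿ)]`, with `W` uniform on the `M` messages and an
independent state sequence that is i.i.d. with letter law `μS`. -/
def Code.power {M n : ℕ} (c : Code M n) (μS : Measure (Fin 2 → ℝ)) : ℝ≥0∞ :=
  ((M : ℝ≥0∞)⁻¹ * ∑ w : Fin M,
    ∫⁻ s, ∑ i : Fin n, ENNReal.ofReal (c.enc w s i ^ 2) ∂(Measure.pi fun _ : Fin n => μS)) / n

/-- The error probability `Pr(⋃ₖ {g_k(Y_kⁿ) ≠ W})`, with `W` uniform on the `M` messages, the states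
i.i.d. with letter law `μS`, the noise pairs i.i.d. with letter law `μZ`, and message, states and
noises mutually independent. -/
def Code.errorProb {M n : ℕ} (c : Code M n) (μS μZ : Measure (Fin 2 → ℝ)) : ℝ≥0∞ :=
  (M : ℝ≥0∞)⁻¹ * ∑ w : Fin M,
    ((Measure.pi fun _ : Fin n => μS).prod (Measure.pi fun _ : Fin n => μZ))
      {p | ∃ k : Fin 2, c.dec k (output (c.enc w p.1) p.1 p.2 k) ≠ w}

/-- `R` (in bits per channel use) is an achievable common-message rate under the power constraint `P`:
there are codes with `⌊2^(nR)⌋` messages and block length `n`, each satisfying the power constraint,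
whose error probability tends to zero. -/
def Achievable (P : ℝ≥0) (μS μZ : Measure (Fin 2 → ℝ)) (R : ℝ) : Prop :=
  0 ≤ R ∧ ∃ c : ∀ n : ℕ, Code ⌊(2 : ℝ) ^ ((n : ℝ) * R)⌋₊ n,
    (∀ n, (c n).power μS ≤ P) ∧ Tendsto (fun n => (c n).errorProb μS μZ) atTop (𝓝 0)

/-- The function `T`. -/
def T (q : ℝ) : ℝ :=
  if 4 < q then 1 / 4 * Real.logb 2 q else 1 / 2 * Real.logb 2 (1 + q / 4)

end

end Multicast

/-! The union error event is at least as likely as the failure of each single receiver, and that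
failure only sees one noise marginal. At the price of a factor 2 in the error, the noises may
therefore be recoupled as `Z₁ = b + a`, `Z₂ = b - a` with independent Gaussian vectors `a`, `b` of
variances `α + β = 1`. Then `D = Y₁ - Y₂ = S₁ - S₂ + 2a` is Gaussian of variance `δ = Qd + 4α` for
every encoder, and `Y₁ = C + b` with `b` independent of `(C, D)`.

In entropy terms, `2 log M ≲ h(Y₁) + h(Y₂) - h(Y₁, Y₂ | W)`, where `h(Y₁, Y₂ | W) = h(D, Y₁ | W) ≥
h(D) + h(b)`, and `h(Y_k)` is at most the entropy of a Gaussian vector of variance `V_k = P + Q_k +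
1 + 2√(P Q_k)` (Cauchy-Schwarz). Maximizing `δβ` over `α + β = 1` produces `T`.

The formal argument avoids entropies. It integrates `log X ≤ X - 1` for a likelihood ratio `X`
between independent Gaussian outputs and the true pair, tilted on the event of correct decoding
(`mul_prob_decode_le`). `two_mul_log_card_le` combines the messages as in Fano's inequality,
`Code.converse_inequality` assembles the bound at fixed block length, and `rate_le_of_log_card_le`
lets `n` tend to infinity. -/

namespace Multicast

/-! ### I.i.d. Gaussian vectors: densities, sums, moments. -/

section GaussianVector

variable {ι : Type*} [Fintype ι]

/-- The law of a vector with i.i.d. centred Gaussian coordinates of variance `v`. -/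
noncomputable def gaussianVec (ι : Type*) [Fintype ι] (v : ℝ≥0) : Measure (ι → ℝ) :=
  Measure.pi fun _ => gaussianReal 0 v

instance (v : ℝ≥0) : IsProbabilityMeasure (gaussianVec ι v) := by
  unfold gaussianVec; infer_instance

/-- The Lebesgue density of `gaussianVec`. -/
noncomputable def gaussianVecPDF (v : ℝ≥0) (x : ι → ℝ) : ℝ :=
  ∏ i, gaussianPDFReal 0 v (x i)

@[fun_prop]
lemma measurable_gaussianVecPDF (v : ℝ≥0) : Measurable (gaussianVecPDF (ι := ι) v) := by
  unfold gaussianVecPDF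
  exact Finset.measurable_prod _ fun i _ =>
    (measurable_gaussianPDFReal 0 v).comp (measurable_pi_apply i)

lemma gaussianVecPDF_pos {v : ℝ≥0} (hv : v ≠ 0) (x : ι → ℝ) : 0 < gaussianVecPDF v x :=
  Finset.prod_pos fun _ _ => gaussianPDFReal_pos _ _ _ hv

lemma log_gaussianVecPDF {v : ℝ≥0} (hv : v ≠ 0) (x : ι → ℝ) :
    Real.log (gaussianVecPDF v x) =
      -(Fintype.card ι / 2 * (Real.log (2 * Real.pi) + Real.log v)) - (∑ i, x i ^ 2) / (2 * v) := by
  have hv' : (0 : ℝ) < v := by positivity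
  have key : ∀ t : ℝ, Real.log (gaussianPDFReal 0 v t) =
      -((Real.log (2 * Real.pi) + Real.log v) / 2) - t ^ 2 / (2 * v) := by
    intro t
    rw [gaussianPDFReal, Real.log_mul (by positivity) (by positivity), Real.log_inv,
      Real.log_sqrt (by positivity), Real.log_exp, Real.log_mul (by positivity) (by positivity)]
    ring
  unfold gaussianVecPDF
  rw [Real.log_prod (fun i _ => (gaussianPDFReal_pos _ _ _ hv).ne')]
  simp only [key]
  rw [Finset.sum_sub_distrib, Finset.sum_div]
  simp
  ring

lemma gaussianVec_eq_withDensity {v : ℝ≥0} (hv : v ≠ 0) :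
    gaussianVec ι v = volume.withDensity fun x => ENNReal.ofReal (gaussianVecPDF v x) := by
  refine Measure.pi_eq fun s hs => ?_
  have hint : ∀ i, Integrable ((s i).indicator (gaussianPDFReal 0 v)) :=
    fun i => (integrable_gaussianPDFReal 0 v).indicator (hs i)
  rw [withDensity_apply _ (MeasurableSet.univ_pi hs),
    ← lintegral_indicator (MeasurableSet.univ_pi hs)]
  have h1 : ∀ x : ι → ℝ, (Set.univ.pi s).indicator
      (fun x => ENNReal.ofReal (gaussianVecPDF v x)) x =
      ENNReal.ofReal (∏ i, (s i).indicator (gaussianPDFReal 0 v) (x i)) := by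
    intro x
    by_cases hx : x ∈ Set.univ.pi s
    · rw [Set.indicator_of_mem hx]
      congr 1
      refine Finset.prod_congr rfl fun i _ => ?_
      rw [Set.indicator_of_mem (hx i trivial)]
    · rw [Set.indicator_of_notMem hx]
      simp only [Set.mem_pi, Set.mem_univ, true_imp_iff, not_forall] at hx
      obtain ⟨i, hi⟩ := hx
      rw [Finset.prod_eq_zero (Finset.mem_univ i) (Set.indicator_of_notMem hi _)]
      simp
  simp_rw [h1]
  rw [← ofReal_integral_eq_lintegral_ofReal]
  · rw [volume_pi, integral_fintype_prod_eq_prod (fun i => (s i).indicator (gaussianPDFReal 0 v)),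
      ENNReal.ofReal_prod_of_nonneg]
    · refine Finset.prod_congr rfl fun i _ => ?_
      rw [integral_indicator (hs i), gaussianReal_apply_eq_integral 0 hv]
    · intro i _
      exact integral_nonneg fun x => Set.indicator_nonneg (fun y _ => gaussianPDFReal_nonneg _ _ _) _
  · exact Integrable.fintype_prod hint
  · exact ae_of_all _ fun x => Finset.prod_nonneg fun i _ =>
      Set.indicator_nonneg (fun y _ => gaussianPDFReal_nonneg _ _ _) _

lemma lintegral_gaussianVec {v : ℝ≥0} (hv : v ≠ 0) {F : (ι → ℝ) → ℝ≥0∞} (hF : Measurable F) :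
    ∫⁻ x, F x ∂gaussianVec ι v = ∫⁻ x, F x * ENNReal.ofReal (gaussianVecPDF v x) := by
  rw [gaussianVec_eq_withDensity hv, lintegral_withDensity_eq_lintegral_mul _ (by fun_prop) hF]
  simp only [Pi.mul_apply, mul_comm]

/-- Passing to Lebesgue measure makes translations and reflections of the outputs available. -/
lemma lintegral_gaussianVec_mul_inv_pdf {v : ℝ≥0} (hv : v ≠ 0) {F : (ι → ℝ) → ℝ≥0∞}
    (hF : Measurable F) :
    ∫⁻ x, F x * ENNReal.ofReal (gaussianVecPDF v x)⁻¹ ∂gaussianVec ι v = ∫⁻ x, F x := by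
  rw [lintegral_gaussianVec hv (by fun_prop)]
  refine lintegral_congr fun x => ?_
  rw [mul_assoc, ← ENNReal.ofReal_mul (inv_nonneg.2 (gaussianVecPDF_pos hv x).le),
    inv_mul_cancel₀ (gaussianVecPDF_pos hv x).ne', ENNReal.ofReal_one, mul_one]

lemma gaussianVec_prod_map_add (v w : ℝ≥0) :
    ((gaussianVec ι v).prod (gaussianVec ι w)).map (fun p => p.1 + p.2) = gaussianVec ι (v + w) := by
  have h := measurePreserving_arrowProdEquivProdArrow ℝ ℝ ι (fun _ => gaussianReal 0 v)
    (fun _ => gaussianReal 0 w)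
  unfold gaussianVec
  rw [← h.map_eq, Measure.map_map (by fun_prop) h.measurable]
  have : ((fun p : (ι → ℝ) × (ι → ℝ) => p.1 + p.2) ∘ MeasurableEquiv.arrowProdEquivProdArrow ℝ ℝ ι) =
      fun x i => (x i).1 + (x i).2 := by
    ext x i
    rfl
  rw [this, Measure.pi_map_pi (f := fun _ (p : ℝ × ℝ) => p.1 + p.2) (fun i => by fun_prop)]
  congr 1
  ext1 i
  have := gaussianReal_conv_gaussianReal (m₁ := 0) (m₂ := 0) (v₁ := v) (v₂ := w)
  rw [Measure.conv, add_zero] at this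
  exact this

lemma gaussianVec_map_const_mul (v : ℝ≥0) (c : ℝ) :
    (gaussianVec ι v).map (fun x i => c * x i) = gaussianVec ι (.mk (c ^ 2) (sq_nonneg _) * v) := by
  unfold gaussianVec
  rw [Measure.pi_map_pi (f := fun _ (x : ℝ) => c * x) (fun i => by fun_prop)]
  simp only [gaussianReal_map_const_mul, mul_zero]

lemma memLp_eval_gaussianVec (v : ℝ≥0) (i : ι) :
    MemLp (fun x : ι → ℝ => x i) 2 (gaussianVec ι v) :=
  (memLp_id_gaussianReal' (μ := 0) (v := v) 2 (by simp)).comp_measurePreserving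
    (measurePreserving_eval (fun _ : ι => gaussianReal 0 v) i)

lemma integrable_sum_sq_gaussianVec (v : ℝ≥0) :
    Integrable (fun x : ι → ℝ => ∑ i, x i ^ 2) (gaussianVec ι v) :=
  integrable_finsetSum _ fun i _ => (memLp_eval_gaussianVec v i).integrable_sq

lemma integral_eval_gaussianVec (v : ℝ≥0) (i : ι) :
    ∫ x, x i ∂gaussianVec ι v = 0 := by
  have h := (measurePreserving_eval (fun _ : ι => gaussianReal 0 v) i)
  have := integral_map (μ := gaussianVec ι v) (φ := fun x => x i) (f := fun x => x)
    (measurable_pi_apply i).aemeasurable (by fun_prop)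
  rw [← this]
  have h2 : (gaussianVec ι v).map (fun x => x i) = gaussianReal 0 v := h.map_eq
  rw [h2, integral_id_gaussianReal]

lemma integral_eval_sq_gaussianVec (v : ℝ≥0) (i : ι) :
    ∫ x, x i ^ 2 ∂gaussianVec ι v = v := by
  have h := (measurePreserving_eval (fun _ : ι => gaussianReal 0 v) i)
  have := integral_map (μ := gaussianVec ι v) (φ := fun x => x i) (f := fun x => x ^ 2)
    (measurable_pi_apply i).aemeasurable (by fun_prop)
  rw [← this]
  have h2 : (gaussianVec ι v).map (fun x => x i) = gaussianReal 0 v := h.map_eq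
  rw [h2]
  have h3 := variance_fun_id_gaussianReal (μ := 0) (v := v)
  rw [variance_eq_integral (by fun_prop)] at h3
  simpa using h3

lemma integral_sum_sq_gaussianVec (v : ℝ≥0) :
    ∫ x, ∑ i, x i ^ 2 ∂gaussianVec ι v = Fintype.card ι * v := by
  rw [integral_finsetSum]
  · simp [integral_eval_sq_gaussianVec]
  · exact fun i _ => (memLp_eval_gaussianVec v i).integrable_sq

end GaussianVector

/-! ### Change of measure to independent Gaussian outputs. -/

section ChangeOfMeasure

variable {ι : Type*} [Fintype ι] {T : Type*} [MeasurableSpace T] {τ : Measure T}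
  {c D : T → ι → ℝ} {β δ : ℝ≥0}

/-- If `D` is Gaussian and `b` is an independent Gaussian vector, then weighting the pair
`(c + b, c + b - D)` with the inverse of the product density of `D` and `b` gives Lebesgue measure,
whatever the dependence between `c` and `D`. -/
lemma lintegral_output_mul_inv_pdf [SFinite τ] (hβ : β ≠ 0) (hδ : δ ≠ 0) (hc : Measurable c)
    (hD : Measurable D) (hlaw : τ.map D = gaussianVec ι δ) {F : (ι → ℝ) → (ι → ℝ) → ℝ≥0∞}
    (hF : Measurable (Function.uncurry F)) :
    ∫⁻ p, F (c p.1 + p.2) (c p.1 + p.2 - D p.1) * ENNReal.ofReal (gaussianVecPDF δ (D p.1))⁻¹ *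
      ENNReal.ofReal (gaussianVecPDF β p.2)⁻¹ ∂(τ.prod (gaussianVec ι β)) =
      ∫⁻ y, ∫⁻ y', F y y' := by
  have hm : Measurable fun p : T × (ι → ℝ) => F (c p.1 + p.2) (c p.1 + p.2 - D p.1) :=
    hF.comp (f := fun p : T × (ι → ℝ) => (c p.1 + p.2, c p.1 + p.2 - D p.1)) (by fun_prop)
  have hK : Measurable fun p : (ι → ℝ) × (ι → ℝ) => F p.2 (p.2 - p.1) :=
    hF.comp (f := fun p : (ι → ℝ) × (ι → ℝ) => (p.2, p.2 - p.1)) (by fun_prop)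
  rw [lintegral_prod _ (by fun_prop)]
  -- Lebesgue measure in `b` absorbs the shift by `c t`. What is left sees `t` only through `D t`,
  -- so the dependence of `c` on `D` is harmless.
  have h1 : ∀ t, ∫⁻ b, F (c t + b) (c t + b - D t) * ENNReal.ofReal (gaussianVecPDF δ (D t))⁻¹ *
      ENNReal.ofReal (gaussianVecPDF β b)⁻¹ ∂(gaussianVec ι β) =
      (∫⁻ y, F y (y - D t)) * ENNReal.ofReal (gaussianVecPDF δ (D t))⁻¹ := by
    intro t
    have hmt : Measurable fun b => F (c t + b) (c t + b - D t) :=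
      hF.comp (f := fun b => (c t + b, c t + b - D t)) (by fun_prop)
    have hmt2 : Measurable fun y => F y (y - D t) :=
      hF.comp (f := fun y => (y, y - D t)) (by fun_prop)
    rw [lintegral_gaussianVec_mul_inv_pdf hβ
      (F := fun b => F (c t + b) (c t + b - D t) * ENNReal.ofReal (gaussianVecPDF δ (D t))⁻¹)
      (by fun_prop), lintegral_mul_const _ hmt,
      lintegral_add_left_eq_self (fun y => F y (y - D t)) (c t)]
  simp only [h1]
  have hK2 : Measurable fun d => ∫⁻ y, F y (y - d) := hK.lintegral_prod_right'
  rw [← lintegral_map (μ := τ) (g := D)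
    (f := fun d => (∫⁻ y, F y (y - d)) * ENNReal.ofReal (gaussianVecPDF δ d)⁻¹) (by fun_prop) hD,
    hlaw, lintegral_gaussianVec_mul_inv_pdf hδ hK2, lintegral_lintegral_swap hK.aemeasurable]
  exact lintegral_congr fun y => lintegral_sub_left_eq_self (fun y' => F y y') y

/-- The probability that two outputs `c + b` and `c + b - D` land in decision regions `A₁` and `A₂`,
bounded through a change of measure to independent Gaussian outputs of variances `V₁`, `V₂`. -/
lemma mul_prob_decode_le [IsProbabilityMeasure τ] (hβ : β ≠ 0) (hδ : δ ≠ 0) (hc : Measurable c)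
    (hD : Measurable D) (hlaw : τ.map D = gaussianVec ι δ) {V₁ V₂ : ℝ≥0} (hV₁ : V₁ ≠ 0)
    (hV₂ : V₂ ≠ 0) {A₁ A₂ : Set (ι → ℝ)} (hA₁ : MeasurableSet A₁) (hA₂ : MeasurableSet A₂)
    (h₁ : Integrable (fun p : T × (ι → ℝ) => ∑ i, (c p.1 + p.2) i ^ 2) (τ.prod (gaussianVec ι β)))
    (h₂ : Integrable (fun p : T × (ι → ℝ) => ∑ i, (c p.1 + p.2 - D p.1) i ^ 2)
      (τ.prod (gaussianVec ι β))) (l : ℝ) :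
    l * (τ.prod (gaussianVec ι β)).real {p | c p.1 + p.2 ∈ A₁ ∧ c p.1 + p.2 - D p.1 ∈ A₂} ≤
      Real.exp l * ((gaussianVec ι V₁).real A₁ * (gaussianVec ι V₂).real A₂) +
      Fintype.card ι / 2 * (Real.log V₁ + Real.log V₂ - Real.log δ - Real.log β - 2) +
      (∫ p, ∑ i, (c p.1 + p.2) i ^ 2 ∂(τ.prod (gaussianVec ι β))) / (2 * V₁) +
      (∫ p, ∑ i, (c p.1 + p.2 - D p.1) i ^ 2 ∂(τ.prod (gaussianVec ι β))) / (2 * V₂) := by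
  set π := τ.prod (gaussianVec ι β) with hπ
  set A : Set (T × (ι → ℝ)) := {p | c p.1 + p.2 ∈ A₁ ∧ c p.1 + p.2 - D p.1 ∈ A₂} with hA
  -- The summand 1 gives `log f ≥ 0` everywhere, while `log f ≥ l` on `A`; its contribution to the
  -- mean of `X` cancels the 1 in `log X ≤ X - 1`.
  set f : (ι → ℝ) → (ι → ℝ) → ℝ := fun y y' =>
    1 + Real.exp l * (A₁.indicator 1 y * A₂.indicator 1 y') with hf
  set X : T × (ι → ℝ) → ℝ := fun p => f (c p.1 + p.2) (c p.1 + p.2 - D p.1) *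
    (gaussianVecPDF V₁ (c p.1 + p.2) * gaussianVecPDF V₂ (c p.1 + p.2 - D p.1)) *
    (gaussianVecPDF δ (D p.1))⁻¹ * (gaussianVecPDF β p.2)⁻¹ with hX
  have hAm : MeasurableSet A := by
    refine MeasurableSet.inter ?_ ?_
    · exact hA₁.preimage (by fun_prop)
    · exact hA₂.preimage (by fun_prop)
  have hi₁ : Measurable (A₁.indicator (1 : (ι → ℝ) → ℝ)) := measurable_one.indicator hA₁
  have hi₂ : Measurable (A₂.indicator (1 : (ι → ℝ) → ℝ)) := measurable_one.indicator hA₂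
  have hn₁ : ∀ y, 0 ≤ A₁.indicator (1 : (ι → ℝ) → ℝ) y :=
    fun y => Set.indicator_nonneg (fun _ _ => zero_le_one) y
  have hn₂ : ∀ y, 0 ≤ A₂.indicator (1 : (ι → ℝ) → ℝ) y :=
    fun y => Set.indicator_nonneg (fun _ _ => zero_le_one) y
  have hf0 : ∀ y y', 1 ≤ f y y' := fun y y' => by
    have := mul_nonneg (Real.exp_pos l).le (mul_nonneg (hn₁ y) (hn₂ y'))
    simp only [hf]; linarith
  have hXm : Measurable X := by simp only [hX, hf]; fun_prop
  have hX0 : ∀ p, 0 ≤ X p := fun p => by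
    have := hf0 (c p.1 + p.2) (c p.1 + p.2 - D p.1)
    have h1 := gaussianVecPDF_pos hV₁ (c p.1 + p.2)
    have h2 := gaussianVecPDF_pos hV₂ (c p.1 + p.2 - D p.1)
    have h3 := gaussianVecPDF_pos hδ (D p.1)
    have h4 := gaussianVecPDF_pos hβ p.2
    simp only [hX]
    positivity
  have hXl : ∫⁻ p, ENNReal.ofReal (X p) ∂π = ENNReal.ofReal
      (1 + Real.exp l * ((gaussianVec ι V₁).real A₁ * (gaussianVec ι V₂).real A₂)) := by
    have e1 : ∀ p, ENNReal.ofReal (X p) = (fun y y' => ENNReal.ofReal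
        (f y y' * (gaussianVecPDF V₁ y * gaussianVecPDF V₂ y'))) (c p.1 + p.2)
          (c p.1 + p.2 - D p.1) * ENNReal.ofReal (gaussianVecPDF δ (D p.1))⁻¹ *
          ENNReal.ofReal (gaussianVecPDF β p.2)⁻¹ := by
      intro p
      have := hf0 (c p.1 + p.2) (c p.1 + p.2 - D p.1)
      have h1 := gaussianVecPDF_pos hV₁ (c p.1 + p.2)
      have h2 := gaussianVecPDF_pos hV₂ (c p.1 + p.2 - D p.1)
      have h3 := gaussianVecPDF_pos hδ (D p.1)
      simp only [hX]
      rw [ENNReal.ofReal_mul (by positivity), ENNReal.ofReal_mul (by positivity)]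
    simp_rw [e1]
    have hfm : Measurable (Function.uncurry fun y y' => ENNReal.ofReal
        (f y y' * (gaussianVecPDF V₁ y * gaussianVecPDF V₂ y'))) := by
      simp only [hf, Function.uncurry_def]
      fun_prop
    rw [lintegral_output_mul_inv_pdf hβ hδ hc hD hlaw hfm]
    have e2 : ∀ y, ∫⁻ y', ENNReal.ofReal
        (f y y' * (gaussianVecPDF V₁ y * gaussianVecPDF V₂ y')) =
        (∫⁻ y', ENNReal.ofReal (f y y') ∂gaussianVec ι V₂) * ENNReal.ofReal (gaussianVecPDF V₁ y) := by
      intro y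
      have hfy : Measurable fun y' => ENNReal.ofReal (f y y') := by simp only [hf]; fun_prop
      rw [lintegral_gaussianVec hV₂ hfy, ← lintegral_mul_const _ (by fun_prop)]
      refine lintegral_congr fun y' => ?_
      rw [← ENNReal.ofReal_mul (by linarith [hf0 y y']),
        ← ENNReal.ofReal_mul (mul_nonneg (by linarith [hf0 y y']) (gaussianVecPDF_pos hV₂ y').le)]
      congr 1; ring
    simp_rw [e2]
    have hfm' : Measurable fun p : (ι → ℝ) × (ι → ℝ) => ENNReal.ofReal (f p.1 p.2) := by
      simp only [hf]; fun_prop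
    rw [← lintegral_gaussianVec hV₁ hfm'.lintegral_prod_right', ← lintegral_prod _ hfm'.aemeasurable]
    have hii : Integrable (fun p : (ι → ℝ) × (ι → ℝ) =>
        A₁.indicator (1 : (ι → ℝ) → ℝ) p.1 * A₂.indicator (1 : (ι → ℝ) → ℝ) p.2)
        ((gaussianVec ι V₁).prod (gaussianVec ι V₂)) :=
      Integrable.mul_prod ((integrable_const (1 : ℝ)).indicator hA₁)
        ((integrable_const (1 : ℝ)).indicator hA₂)
    rw [← ofReal_integral_eq_lintegral_ofReal]
    · congr 1
      simp only [hf]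
      rw [integral_add (integrable_const _) (hii.const_mul _), integral_const_mul,
        integral_prod_mul (A₁.indicator (1 : (ι → ℝ) → ℝ)) (A₂.indicator (1 : (ι → ℝ) → ℝ)),
        integral_indicator_one hA₁, integral_indicator_one hA₂]
      simp
    · exact (integrable_const _).add (hii.const_mul _)
    · exact ae_of_all _ fun p => zero_le_one.trans (hf0 p.1 p.2)
  have hq0 : 0 ≤ 1 + Real.exp l * ((gaussianVec ι V₁).real A₁ * (gaussianVec ι V₂).real A₂) := by
    positivity
  have hXi : Integrable X π := by
    refine ⟨hXm.aestronglyMeasurable, ?_⟩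
    rw [hasFiniteIntegral_iff_ofReal (ae_of_all _ hX0), hXl]
    exact ENNReal.ofReal_lt_top
  have hXe : ∫ p, X p ∂π =
      1 + Real.exp l * ((gaussianVec ι V₁).real A₁ * (gaussianVec ι V₂).real A₂) := by
    rw [integral_eq_lintegral_of_nonneg_ae (ae_of_all _ hX0) hXm.aestronglyMeasurable, hXl,
      ENNReal.toReal_ofReal hq0]
  have hmpD : MeasurePreserving (fun p : T × (ι → ℝ) => D p.1) π (gaussianVec ι δ) :=
    (⟨hD, hlaw⟩ : MeasurePreserving D τ (gaussianVec ι δ)).comp measurePreserving_fst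
  have hmpb : MeasurePreserving (fun p : T × (ι → ℝ) => p.2) π (gaussianVec ι β) :=
    measurePreserving_snd
  have hDi : Integrable (fun p : T × (ι → ℝ) => ∑ i, D p.1 i ^ 2) π :=
    hmpD.integrable_comp_of_integrable (integrable_sum_sq_gaussianVec δ)
  have hbi : Integrable (fun p : T × (ι → ℝ) => ∑ i, p.2 i ^ 2) π :=
    hmpb.integrable_comp_of_integrable (integrable_sum_sq_gaussianVec β)
  have hDe : ∫ p, ∑ i, D p.1 i ^ 2 ∂π = Fintype.card ι * δ := by
    rw [← integral_sum_sq_gaussianVec, ← hmpD.map_eq, integral_map hmpD.aemeasurable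
      (Continuous.aestronglyMeasurable (by fun_prop))]
  have hbe : ∫ p, ∑ i, p.2 i ^ 2 ∂π = Fintype.card ι * β := by
    rw [← integral_sum_sq_gaussianVec, ← hmpb.map_eq, integral_map hmpb.aemeasurable
      (Continuous.aestronglyMeasurable (by fun_prop))]
  -- This is `log X ≤ X - 1` with the Gaussian log-densities written out; the factors `2π` cancel,
  -- two densities against two.
  have hpt : ∀ p, l * A.indicator 1 p +
      (-(Fintype.card ι / 2 * (Real.log V₁ + Real.log V₂ - Real.log δ - Real.log β))
        - (∑ i, (c p.1 + p.2) i ^ 2) / (2 * V₁) - (∑ i, (c p.1 + p.2 - D p.1) i ^ 2) / (2 * V₂)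
        + (∑ i, D p.1 i ^ 2) / (2 * δ) + (∑ i, p.2 i ^ 2) / (2 * β)) ≤ X p - 1 := by
    intro p
    have := hf0 (c p.1 + p.2) (c p.1 + p.2 - D p.1)
    have h1 := gaussianVecPDF_pos hV₁ (c p.1 + p.2)
    have h2 := gaussianVecPDF_pos hV₂ (c p.1 + p.2 - D p.1)
    have h3 := gaussianVecPDF_pos hδ (D p.1)
    have h4 := gaussianVecPDF_pos hβ p.2
    have hfpos : 0 < f (c p.1 + p.2) (c p.1 + p.2 - D p.1) := by linarith
    have hXpos : 0 < X p := by simp only [hX]; positivity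
    refine le_trans ?_ (Real.log_le_sub_one_of_pos hXpos)
    have hlf : l * A.indicator 1 p ≤ Real.log (f (c p.1 + p.2) (c p.1 + p.2 - D p.1)) := by
      by_cases hp : p ∈ A
      · rw [Set.indicator_of_mem hp]
        have : f (c p.1 + p.2) (c p.1 + p.2 - D p.1) = 1 + Real.exp l := by
          simp only [hf]
          rw [Set.indicator_of_mem hp.1, Set.indicator_of_mem hp.2]; simp
        rw [this, Pi.one_apply, mul_one, Real.le_log_iff_exp_le (by positivity)]
        linarith
      · rw [Set.indicator_of_notMem hp, mul_zero]
        exact Real.log_nonneg this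
    simp only [hX]
    rw [Real.log_mul (by positivity) (by positivity), Real.log_mul (by positivity) (by positivity),
      Real.log_mul (by positivity) (by positivity), Real.log_mul (by positivity) (by positivity),
      Real.log_inv, Real.log_inv, log_gaussianVecPDF hV₁, log_gaussianVecPDF hV₂,
      log_gaussianVecPDF hδ, log_gaussianVecPDF hβ]
    linarith
  have hAi : Integrable (A.indicator (1 : T × (ι → ℝ) → ℝ)) π :=
    (integrable_const (1 : ℝ)).indicator hAm
  have h1' := h₁.div_const (2 * (V₁ : ℝ))
  have h2' := h₂.div_const (2 * (V₂ : ℝ))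
  have hD' := hDi.div_const (2 * (δ : ℝ))
  have hb' := hbi.div_const (2 * (β : ℝ))
  have hc' : Integrable (fun _ : T × (ι → ℝ) =>
      -(Fintype.card ι / 2 * (Real.log V₁ + Real.log V₂ - Real.log δ - Real.log β))) π :=
    integrable_const _
  have hmono := integral_mono ((hAi.const_mul l).add ((((hc'.sub h1').sub h2').add hD').add hb'))
    (hXi.sub (integrable_const 1)) hpt
  rw [integral_add' (hAi.const_mul l) ((((hc'.sub h1').sub h2').add hD').add hb'),
    integral_add' (((hc'.sub h1').sub h2').add hD') hb',
    integral_add' ((hc'.sub h1').sub h2') hD', integral_sub' (hc'.sub h1') h2',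
    integral_sub' hc' h1', integral_sub' hXi (integrable_const 1), integral_const_mul,
    integral_indicator_one hAm, integral_div, integral_div, integral_div, integral_div, hDe, hbe,
    hXe] at hmono
  simp only [integral_const, probReal_univ, one_smul] at hmono
  -- The second moments of `D` and `b` are known exactly; together they give the `-2` in the bound.
  have eδ : (Fintype.card ι : ℝ) * δ / (2 * δ) = Fintype.card ι / 2 := by field_simp
  have eβ : (Fintype.card ι : ℝ) * β / (2 * β) = Fintype.card ι / 2 := by field_simp
  rw [eδ, eβ] at hmono
  linarith

end ChangeOfMeasure

/-! ### Fano's inequality for two decoders. -/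

/-- A form of Fano's inequality for two decoders, phrased with the exponential test functions of
a change of measure. -/
lemma two_mul_log_card_le {M : ℕ} (hM : 0 < M) {a b p E : Fin M → ℝ} (ha : ∀ w, 0 ≤ a w)
    (hb : ∀ w, 0 ≤ b w) (hasum : ∑ w, a w ≤ 1) (hbsum : ∑ w, b w ≤ 1) (hp : ∀ w, p w ≤ 1)
    (h : ∀ w l, l * p w ≤ Real.exp l * (a w * b w) + E w) :
    M * (2 * Real.log M) - 2 * Real.log (2 * M) * ∑ w, (1 - p w) ≤ M * 4 + ∑ w, E w := by
  have hM' : (0 : ℝ) < M := by exact_mod_cast hM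
  -- Averaging with the uniform law keeps `f ≥ 1 / (2M)`, so its logarithm stays bounded even where
  -- `a w` or `b w` vanishes, and costs only a factor 2.
  set f : ℝ → ℝ := fun t => (t + (M : ℝ)⁻¹) / 2 with hf
  have hfpos : ∀ {t}, 0 ≤ t → 0 < f t := fun {t} ht => by simp only [hf]; positivity
  have hflow : ∀ {t}, 0 ≤ t → -Real.log (f t) ≤ Real.log (2 * M) := fun {t} ht => by
    rw [← Real.log_inv]
    refine Real.log_le_log (inv_pos.2 (hfpos ht)) ?_
    rw [inv_le_comm₀ (hfpos ht) (by positivity)]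
    simp only [hf]
    rw [mul_inv]
    linarith
  have hfsum : ∀ g : Fin M → ℝ, (∀ w, 0 ≤ g w) → ∑ w, g w ≤ 1 →
      M * Real.log M ≤ ∑ w, -Real.log (f (g w)) := fun g hg hs => by
    -- Jensen's inequality for `-log`, through the tangent line at the uniform value `1 / M`.
    have h1 : ∀ w, Real.log M + (1 - M * f (g w)) ≤ -Real.log (f (g w)) := fun w => by
      have := Real.log_le_sub_one_of_pos (mul_pos hM' (hfpos (hg w)))
      rw [Real.log_mul hM'.ne' (hfpos (hg w)).ne'] at this
      linarith
    refine le_trans ?_ (Finset.sum_le_sum fun w _ => h1 w)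
    have h2 : ∑ w, f (g w) ≤ 1 := by
      simp only [hf]
      rw [← Finset.sum_div, Finset.sum_add_distrib]
      simp only [Finset.sum_const, Finset.card_univ, Fintype.card_fin, nsmul_eq_mul]
      rw [mul_inv_cancel₀ hM'.ne']
      linarith
    rw [Finset.sum_add_distrib, Finset.sum_sub_distrib, ← Finset.mul_sum]
    simp only [Finset.sum_const, Finset.card_univ, Fintype.card_fin, nsmul_eq_mul]
    nlinarith
  have key : ∀ w, (-Real.log (f (a w)) + -Real.log (f (b w))) - 2 * Real.log (2 * M) * (1 - p w) ≤
      4 + E w := fun w => by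
    -- With this `l`, the exponential term is at most `2 * 2 = 4`, and `l` itself sums to at least
    -- `2 M log M`.
    have h1 := h w (-Real.log (f (a w)) + -Real.log (f (b w)))
    have hfa := hfpos (ha w)
    have hfb := hfpos (hb w)
    rw [Real.exp_add, Real.exp_neg, Real.exp_neg, Real.exp_log hfa, Real.exp_log hfb] at h1
    have h2 : ∀ {t}, 0 ≤ t → (f t)⁻¹ * t ≤ 2 := fun {t} ht => by
      rw [inv_mul_le_iff₀ (hfpos ht)]
      simp only [hf]
      have : 0 < (M : ℝ)⁻¹ := by positivity
      linarith
    have h3 : (f (a w))⁻¹ * (f (b w))⁻¹ * (a w * b w) ≤ 4 := by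
      have := mul_le_mul (h2 (ha w)) (h2 (hb w)) (mul_nonneg (inv_nonneg.2 hfb.le) (hb w)) (by norm_num)
      linarith
    have h4 : (-Real.log (f (a w)) + -Real.log (f (b w))) * (1 - p w) ≤
        2 * Real.log (2 * M) * (1 - p w) :=
      mul_le_mul_of_nonneg_right (by linarith [hflow (ha w), hflow (hb w)]) (by linarith [hp w])
    linarith
  have hsum := Finset.sum_le_sum fun w (_ : w ∈ Finset.univ) => key w
  rw [Finset.sum_sub_distrib, Finset.sum_add_distrib, Finset.sum_add_distrib, ← Finset.mul_sum] at hsum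
  simp only [Finset.sum_const, Finset.card_univ, Fintype.card_fin, nsmul_eq_mul] at hsum
  have := hfsum a ha hasum
  have := hfsum b hb hbsum
  linarith

/-! ### The noise coupling and second moments. -/

/-- A coupling of two noise vectors from independent vectors `a` and `b`, as `b + a` and `b - a`. -/
def noise {ι : Type*} (k : Fin 2) (a b : ι → ℝ) : ι → ℝ := if k = 0 then a + b else -a + b

lemma noise_zero {ι : Type*} (a b : ι → ℝ) : noise 0 a b = a + b := by simp [noise]

lemma noise_one {ι : Type*} (a b : ι → ℝ) : noise 1 a b = -a + b := by simp [noise]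

section Noise

variable {ι : Type*} [Fintype ι]

lemma gaussianVec_map_neg (v : ℝ≥0) : (gaussianVec ι v).map (fun x => -x) = gaussianVec ι v := by
  have h := gaussianVec_map_const_mul (ι := ι) v (-1)
  have e : (NNReal.mk ((-1 : ℝ) ^ 2) (sq_nonneg _)) = 1 := by ext; simp
  rw [e, one_mul] at h
  convert h using 2
  ext x i
  simp

lemma measurePreserving_noise {α β : ℝ≥0} (k : Fin 2) :
    MeasurePreserving (fun p : (ι → ℝ) × (ι → ℝ) => noise k p.1 p.2)
      ((gaussianVec ι α).prod (gaussianVec ι β)) (gaussianVec ι (α + β)) := by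
  have hadd : MeasurePreserving (fun p : (ι → ℝ) × (ι → ℝ) => p.1 + p.2)
      ((gaussianVec ι α).prod (gaussianVec ι β)) (gaussianVec ι (α + β)) :=
    ⟨by fun_prop, gaussianVec_prod_map_add α β⟩
  have hneg : MeasurePreserving (fun x : ι → ℝ => -x) (gaussianVec ι α) (gaussianVec ι α) :=
    ⟨by fun_prop, gaussianVec_map_neg α⟩
  fin_cases k
  · simpa [noise] using hadd
  · have := hadd.comp (hneg.prod (MeasurePreserving.id (gaussianVec ι β)))
    simpa [noise, Function.comp_def] using this

lemma measurePreserving_state_noise {S : Type*} [MeasurableSpace S] (ν : Measure S)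
    [IsProbabilityMeasure ν] {α β : ℝ≥0} (k : Fin 2) :
    MeasurePreserving (fun p : (S × (ι → ℝ)) × (ι → ℝ) => (p.1.1, noise k p.1.2 p.2))
      ((ν.prod (gaussianVec ι α)).prod (gaussianVec ι β)) (ν.prod (gaussianVec ι (α + β))) :=
  ((MeasurePreserving.id ν).prod (measurePreserving_noise k)).comp
    (measurePreserving_prodAssoc ν (gaussianVec ι α) (gaussianVec ι β))

/-- The input cancels in the output difference, leaving `S₁ - S₂ + (a + b) - (b - a)`; doubling `a`
multiplies its variance by 4. -/
lemma map_state_difference {μS : Measure (Fin 2 → ℝ)} [IsProbabilityMeasure μS] {Qd : ℝ≥0}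
    (hd : μS.map (fun s => s 0 - s 1) = gaussianReal 0 Qd) (α : ℝ≥0) :
    ((Measure.pi fun _ : ι => μS).prod (gaussianVec ι α)).map
      (fun p i => p.1 i 0 - p.1 i 1 + 2 * p.2 i) = gaussianVec ι (Qd + 4 * α) := by
  have h1 : MeasurePreserving (fun (s : ι → Fin 2 → ℝ) i => s i 0 - s i 1)
      (Measure.pi fun _ : ι => μS) (gaussianVec ι Qd) :=
    measurePreserving_pi _ _ fun _ => ⟨by fun_prop, hd⟩
  have e : (NNReal.mk ((2 : ℝ) ^ 2) (sq_nonneg _)) = 4 := by ext; norm_num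
  have h2 : MeasurePreserving (fun (a : ι → ℝ) i => 2 * a i) (gaussianVec ι α)
      (gaussianVec ι (4 * α)) := by
    refine ⟨by fun_prop, ?_⟩
    rw [gaussianVec_map_const_mul, e]
  have h3 : MeasurePreserving (fun p : (ι → ℝ) × (ι → ℝ) => p.1 + p.2)
      ((gaussianVec ι Qd).prod (gaussianVec ι (4 * α))) (gaussianVec ι (Qd + 4 * α)) :=
    ⟨by fun_prop, gaussianVec_prod_map_add _ _⟩
  exact (h3.comp (h1.prod h2)).map_eq

lemma integral_sq_add_gaussianVec {S : Type*} [MeasurableSpace S] {ν : Measure S}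
    [IsProbabilityMeasure ν] {u : S → ι → ℝ} (hu : ∀ i, MemLp (fun s => u s i) 2 ν) (v : ℝ≥0) :
    Integrable (fun p : S × (ι → ℝ) => ∑ i, (u p.1 i + p.2 i) ^ 2) (ν.prod (gaussianVec ι v)) ∧
    ∫ p, ∑ i, (u p.1 i + p.2 i) ^ 2 ∂(ν.prod (gaussianVec ι v)) =
      ∑ i, ∫ s, u s i ^ 2 ∂ν + Fintype.card ι * v := by
  have hu' : ∀ i, MemLp (fun p : S × (ι → ℝ) => u p.1 i) 2 (ν.prod (gaussianVec ι v)) :=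
    fun i => (hu i).comp_measurePreserving measurePreserving_fst
  have hz' : ∀ i, MemLp (fun p : S × (ι → ℝ) => p.2 i) 2 (ν.prod (gaussianVec ι v)) :=
    fun i => (memLp_eval_gaussianVec v i).comp_measurePreserving measurePreserving_snd
  have hi : ∀ i, Integrable (fun p : S × (ι → ℝ) => (u p.1 i + p.2 i) ^ 2)
      (ν.prod (gaussianVec ι v)) := fun i => ((hu' i).add (hz' i)).integrable_sq
  refine ⟨integrable_finsetSum _ fun i _ => hi i, ?_⟩
  rw [integral_finsetSum _ fun i _ => hi i]
  have key : ∀ i, ∫ p, (u p.1 i + p.2 i) ^ 2 ∂(ν.prod (gaussianVec ι v)) = ∫ s, u s i ^ 2 ∂ν + v := by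
    intro i
    have hm : Integrable (fun p : S × (ι → ℝ) => u p.1 i * p.2 i) (ν.prod (gaussianVec ι v)) :=
      (hu' i).integrable_mul (hz' i)
    have e : ∀ p : S × (ι → ℝ), (u p.1 i + p.2 i) ^ 2 =
        u p.1 i ^ 2 + (2 * (u p.1 i * p.2 i) + p.2 i ^ 2) := fun p => by ring
    simp_rw [e]
    have hz2 := (hz' i).integrable_sq
    have hmz : Integrable (fun p : S × (ι → ℝ) => 2 * (u p.1 i * p.2 i) + p.2 i ^ 2)
        (ν.prod (gaussianVec ι v)) := (hm.const_mul 2).add hz2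
    rw [integral_add (hu' i).integrable_sq hmz,
      integral_add (hm.const_mul 2) hz2, integral_const_mul,
      integral_prod_mul (fun s => u s i) (fun z : ι → ℝ => z i), integral_eval_gaussianVec,
      integral_fun_fst (fun s => u s i ^ 2), integral_fun_snd (fun z : ι → ℝ => z i ^ 2),
      integral_eval_sq_gaussianVec]
    simp
  simp_rw [key]
  rw [Finset.sum_add_distrib]
  simp

end Noise

/-- Cauchy-Schwarz for a sum of two finite families of square integrable functions. -/
lemma sum_integral_add_sq_le {κ S : Type*} [MeasurableSpace S] {ν : Measure S} (J : Finset κ)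
    {x y : κ → S → ℝ} (hx : ∀ j ∈ J, MemLp (x j) 2 ν) (hy : ∀ j ∈ J, MemLp (y j) 2 ν) {A C : ℝ}
    (hA : ∑ j ∈ J, ∫ s, x j s ^ 2 ∂ν ≤ A) (hC : ∑ j ∈ J, ∫ s, y j s ^ 2 ∂ν ≤ C) :
    ∑ j ∈ J, ∫ s, (x j s + y j s) ^ 2 ∂ν ≤ A + C + 2 * √(A * C) := by
  set A' := ∑ j ∈ J, ∫ s, x j s ^ 2 ∂ν with hA'
  set B := ∑ j ∈ J, ∫ s, x j s * y j s ∂ν with hB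
  set C' := ∑ j ∈ J, ∫ s, y j s ^ 2 ∂ν with hC'
  have hA0 : 0 ≤ A' := Finset.sum_nonneg fun j _ => integral_nonneg fun s => sq_nonneg _
  have hC0 : 0 ≤ C' := Finset.sum_nonneg fun j _ => integral_nonneg fun s => sq_nonneg _
  have expand : ∀ t : ℝ, ∑ j ∈ J, ∫ s, (t * x j s + y j s) ^ 2 ∂ν =
      A' * (t * t) + 2 * B * t + C' := by
    intro t
    have e : ∀ j ∈ J, ∫ s, (t * x j s + y j s) ^ 2 ∂ν =
        (∫ s, x j s ^ 2 ∂ν) * (t * t) + 2 * (∫ s, x j s * y j s ∂ν) * t + ∫ s, y j s ^ 2 ∂ν := by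
      intro j hj
      have hm : Integrable (fun s => x j s * y j s) ν := (hx j hj).integrable_mul (hy j hj)
      have e : ∀ s, (t * x j s + y j s) ^ 2 =
        t * t * x j s ^ 2 + (2 * t * (x j s * y j s) + y j s ^ 2) := fun s => by ring
      simp_rw [e]
      have h1 := (hx j hj).integrable_sq
      have h2 := (hy j hj).integrable_sq
      have hmy : Integrable (fun s => 2 * t * (x j s * y j s) + y j s ^ 2) ν :=
        (hm.const_mul _).add h2
      rw [integral_add (h1.const_mul _) hmy,
        integral_add (hm.const_mul _) h2, integral_const_mul, integral_const_mul]
      ring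
    rw [Finset.sum_congr rfl e, Finset.sum_add_distrib, Finset.sum_add_distrib, ← Finset.sum_mul,
      ← Finset.sum_mul, ← Finset.mul_sum]
  -- A quadratic in `t` that is a sum of integrals of squares has nonpositive discriminant: `B² ≤ A'
  -- C'`.
  have hd := discrim_le_zero (a := A') (b := 2 * B) (c := C') fun t => by
    rw [← expand t]
    exact Finset.sum_nonneg fun j _ => integral_nonneg fun s => sq_nonneg _
  have hB2 : B ≤ √(A * C) := by
    refine Real.le_sqrt_of_sq_le ?_
    have : B ^ 2 ≤ A' * C' := by unfold discrim at hd; linarith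
    exact this.trans (mul_le_mul hA hC hC0 (hA0.trans hA))
  have := expand 1
  simp only [one_mul, mul_one] at this
  rw [this]
  linarith

/-! ### The converse at fixed block length. -/

namespace Code

variable {M n : ℕ} (c : Code M n) {μS μZ : Measure (Fin 2 → ℝ)}

lemma measurable_enc_eval (w : Fin M) (i : Fin n) : Measurable fun s => c.enc w s i :=
  (measurable_pi_apply i).comp (c.measurable_enc w)

lemma memLp_enc_and_sum_sq_le (hM : 0 < M) (hn : 0 < n) {P : ℝ≥0} (hP : c.power μS ≤ P) :
    (∀ w i, MemLp (fun s => c.enc w s i) 2 (Measure.pi fun _ : Fin n => μS)) ∧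
    ∑ j : Fin M × Fin n, ∫ s, c.enc j.1 s j.2 ^ 2 ∂(Measure.pi fun _ : Fin n => μS) ≤
      M * n * P := by
  set ν := Measure.pi fun _ : Fin n => μS with hν
  have hle : ∑ j : Fin M × Fin n, ∫⁻ s, ENNReal.ofReal (c.enc j.1 s j.2 ^ 2) ∂ν ≤
      ENNReal.ofReal (M * n * P) := by
    have hM0 : (M : ℝ≥0∞) ≠ 0 := by exact_mod_cast hM.ne'
    have hn0 : (n : ℝ≥0∞) ≠ 0 := by exact_mod_cast hn.ne'
    unfold Code.power at hP
    rw [ENNReal.div_le_iff hn0 (ENNReal.natCast_ne_top n), mul_comm, ← div_eq_mul_inv,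
      ENNReal.div_le_iff hM0 (ENNReal.natCast_ne_top M)] at hP
    rw [Fintype.sum_prod_type]
    have e : ENNReal.ofReal (M * n * P) = P * n * M := by
      rw [ENNReal.ofReal_mul (by positivity), ENNReal.ofReal_mul (by positivity),
        ENNReal.ofReal_natCast, ENNReal.ofReal_natCast, ENNReal.ofReal_coe_nnreal]
      ring
    rw [e]
    refine le_trans (le_of_eq ?_) hP
    refine Finset.sum_congr rfl fun w _ => ?_
    rw [lintegral_finsetSum]
    intro i _
    exact ((c.measurable_enc_eval w i).pow_const 2).ennreal_ofReal
  have hint : ∀ w i, Integrable (fun s => c.enc w s i ^ 2) ν := by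
    intro w i
    refine ⟨((c.measurable_enc_eval w i).pow_const 2).aestronglyMeasurable, ?_⟩
    rw [hasFiniteIntegral_iff_ofReal (ae_of_all _ fun s => sq_nonneg _)]
    refine lt_of_le_of_lt ?_ (lt_of_le_of_lt hle ENNReal.ofReal_lt_top)
    exact Finset.single_le_sum
      (f := fun j : Fin M × Fin n => ∫⁻ s, ENNReal.ofReal (c.enc j.1 s j.2 ^ 2) ∂ν)
      (fun _ _ => zero_le) (Finset.mem_univ (w, i))
  refine ⟨fun w i => (memLp_two_iff_integrable_sq
    (c.measurable_enc_eval w i).aestronglyMeasurable).2 (hint w i), ?_⟩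
  rw [← ENNReal.ofReal_le_ofReal_iff (by positivity), ENNReal.ofReal_sum_of_nonneg
    fun j _ => integral_nonneg fun s => sq_nonneg _]
  refine le_trans (le_of_eq (Finset.sum_congr rfl fun j _ => ?_)) hle
  exact ofReal_integral_eq_lintegral_ofReal (hint j.1 j.2) (ae_of_all _ fun s => sq_nonneg _)

/-- The second moments of the outputs at receiver `k`, summed over all messages. -/
lemma integral_output_sq [IsProbabilityMeasure μS] (hM : 0 < M) (hn : 0 < n) {P : ℝ≥0}
    (hP : c.power μS ≤ P) {k : Fin 2} {q : ℝ≥0} (hS : μS.map (fun s => s k) = gaussianReal 0 q) :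
    (∀ w, Integrable (fun p : (Fin n → Fin 2 → ℝ) × (Fin n → ℝ) =>
      ∑ i, (c.enc w p.1 i + p.1 i k + p.2 i) ^ 2)
        ((Measure.pi fun _ : Fin n => μS).prod (gaussianVec (Fin n) 1))) ∧
    ∑ w, ∫ p, ∑ i, (c.enc w p.1 i + p.1 i k + p.2 i) ^ 2
      ∂((Measure.pi fun _ : Fin n => μS).prod (gaussianVec (Fin n) 1)) ≤
        M * n * (P + q + 1 + 2 * √(P * q)) := by
  set ν := Measure.pi fun _ : Fin n => μS with hν
  obtain ⟨hx, hxsum⟩ := c.memLp_enc_and_sum_sq_le hM hn hP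
  have hmp : ∀ i, MeasurePreserving (fun s : Fin n → Fin 2 → ℝ => s i k) ν (gaussianReal 0 q) :=
    fun i => (⟨by fun_prop, hS⟩ : MeasurePreserving (fun s : Fin 2 → ℝ => s k) μS _).comp
      (measurePreserving_eval (fun _ : Fin n => μS) i)
  have hs : ∀ i, MemLp (fun s : Fin n → Fin 2 → ℝ => s i k) 2 ν := fun i =>
    (memLp_id_gaussianReal' (μ := 0) (v := q) 2 (by simp)).comp_measurePreserving (hmp i)
  have hse : ∀ i, ∫ s, s i k ^ 2 ∂ν = q := fun i => by
    have h3 := variance_fun_id_gaussianReal (μ := 0) (v := q)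
    rw [variance_eq_integral (by fun_prop)] at h3
    rw [← integral_map (hmp i).aemeasurable (f := fun x => x ^ 2) (by fun_prop), (hmp i).map_eq]
    simpa using h3
  have hu : ∀ w i, MemLp (fun s : Fin n → Fin 2 → ℝ => c.enc w s i + s i k) 2 ν :=
    fun w i => (hx w i).add (hs i)
  refine ⟨fun w => (integral_sq_add_gaussianVec (u := fun s i => c.enc w s i + s i k)
    (hu w) 1).1, ?_⟩
  have e : ∀ w, ∫ p, ∑ i, (c.enc w p.1 i + p.1 i k + p.2 i) ^ 2 ∂(ν.prod (gaussianVec (Fin n) 1)) =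
      ∑ i, ∫ s, (c.enc w s i + s i k) ^ 2 ∂ν + n := fun w => by
    rw [(integral_sq_add_gaussianVec (u := fun s i => c.enc w s i + s i k) (hu w) 1).2]
    simp
  simp_rw [e]
  rw [Finset.sum_add_distrib, ← Fintype.sum_prod_type'
    (f := fun w i => ∫ s, (c.enc w s i + s i k) ^ 2 ∂ν)]
  -- Cauchy-Schwarz runs jointly over messages and times, because the power is only constrained on
  -- average over both.
  have hcs := sum_integral_add_sq_le (ν := ν) (Finset.univ : Finset (Fin M × Fin n))
    (x := fun j s => c.enc j.1 s j.2) (y := fun j s => s j.2 k) (A := M * n * P) (C := M * n * q)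
    (fun j _ => hx j.1 j.2) (fun j _ => hs j.2) hxsum (by simp [hse])
  have hsq : √((M * n * P : ℝ) * (M * n * q)) = M * n * √(P * q) := by
    rw [show (M * n * P : ℝ) * (M * n * q) = (M * n) ^ 2 * (P * q) by ring,
      Real.sqrt_mul (by positivity), Real.sqrt_sq (by positivity)]
  rw [hsq] at hcs
  simp only [Finset.sum_const, Finset.card_univ, Fintype.card_fin, nsmul_eq_mul]
  linarith

/-- Receiver `k` fails at most as often as some receiver does; this only involves the marginal law
of the noise at receiver `k`. -/
lemma sum_prob_decode_ne_le [IsProbabilityMeasure μS] [IsProbabilityMeasure μZ] {k : Fin 2}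
    (hZ : μZ.map (fun z => z k) = gaussianReal 0 1) :
    ∑ w, ((Measure.pi fun _ : Fin n => μS).prod (gaussianVec (Fin n) 1)).real
      {p | c.dec k (fun i => c.enc w p.1 i + p.1 i k + p.2 i) ≠ w} ≤
      M * (c.errorProb μS μZ).toReal := by
  rcases Nat.eq_zero_or_pos M with rfl | hM
  · simp
  set ν := Measure.pi fun _ : Fin n => μS with hν
  have hmp : MeasurePreserving (fun p : (Fin n → Fin 2 → ℝ) × (Fin n → Fin 2 → ℝ) =>
      (p.1, fun i => p.2 i k)) (ν.prod (Measure.pi fun _ : Fin n => μZ))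
      (ν.prod (gaussianVec (Fin n) 1)) :=
    (MeasurePreserving.id ν).prod (measurePreserving_pi (fun _ : Fin n => μZ)
      (fun _ => gaussianReal 0 1) fun _ => ⟨by fun_prop, hZ⟩)
  have e : (M : ℝ) * (c.errorProb μS μZ).toReal =
      ∑ w, (ν.prod (Measure.pi fun _ : Fin n => μZ)).real
        {p | ∃ k : Fin 2, c.dec k (output (c.enc w p.1) p.1 p.2 k) ≠ w} := by
    unfold Code.errorProb
    rw [ENNReal.toReal_mul, ENNReal.toReal_inv, ENNReal.toReal_natCast, ENNReal.toReal_sum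
      fun w _ => measure_ne_top _ _, mul_inv_cancel_left₀ (by exact_mod_cast hM.ne')]
    rfl
  rw [e]
  refine Finset.sum_le_sum fun w _ => ?_
  have hmeas : MeasurableSet {p : (Fin n → Fin 2 → ℝ) × (Fin n → ℝ) |
      c.dec k (fun i => c.enc w p.1 i + p.1 i k + p.2 i) ≠ w} := by
    have hy : Measurable fun p : (Fin n → Fin 2 → ℝ) × (Fin n → ℝ) =>
        fun i => c.enc w p.1 i + p.1 i k + p.2 i := by
      have := fun i => c.measurable_enc_eval w i
      fun_prop
    exact ((c.measurable_dec k).comp hy) (measurableSet_singleton w).compl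
  rw [← hmp.measureReal_preimage hmeas.nullMeasurableSet]
  exact measureReal_mono (fun p hp => ⟨k, hp⟩)

/-- The finite block length converse, for a coupling of the noises with free parameters `α + β = 1`. -/
lemma converse_inequality [IsProbabilityMeasure μS] [IsProbabilityMeasure μZ]
    (hM : 0 < M) (hn : 0 < n) {P Qd : ℝ≥0} {Q : Fin 2 → ℝ≥0}
    (hS : ∀ k, μS.map (fun s => s k) = gaussianReal 0 (Q k))
    (hd : μS.map (fun s => s 0 - s 1) = gaussianReal 0 Qd)
    (hZ : ∀ k, μZ.map (fun z => z k) = gaussianReal 0 1) (hP : c.power μS ≤ P)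
    {α β : ℝ≥0} (hαβ : α + β = 1) (hβ : β ≠ 0) (hδ : Qd + 4 * α ≠ 0) :
    2 * Real.log M - 4 * Real.log (2 * M) * (c.errorProb μS μZ).toReal ≤
      4 + n / 2 * (∑ k, Real.log (P + Q k + 1 + 2 * √(P * Q k)) -
        Real.log ((Qd + 4 * α : ℝ≥0) : ℝ) - Real.log β) := by
  set ν := Measure.pi fun _ : Fin n => μS with hν
  set τ := ν.prod (gaussianVec (Fin n) α) with hτ
  set π := τ.prod (gaussianVec (Fin n) β) with hπ
  have hM' : (0 : ℝ) < M := by exact_mod_cast hM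
  -- The reference variance equals the bound on the mean output power, which makes the quadratic
  -- terms cancel in the end.
  set V : Fin 2 → ℝ≥0 := fun k => P + Q k + 1 + 2 * NNReal.sqrt (P * Q k) with hV
  have hVc : ∀ k, (V k : ℝ) = P + Q k + 1 + 2 * √(P * Q k) := fun k => by simp [hV]
  have hV0 : ∀ k, V k ≠ 0 := fun k => by simp [hV]
  have hVpos : ∀ k, (0 : ℝ) < V k := fun k => by have := hV0 k; positivity
  set Y : Fin M → Fin 2 → (Fin n → Fin 2 → ℝ) × (Fin n → ℝ) → Fin n → ℝ :=
    fun w k p i => c.enc w p.1 i + p.1 i k + p.2 i with hY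
  have hYm : ∀ w k, Measurable (Y w k) := fun w k => by
    have := fun i => c.measurable_enc_eval w i
    simp only [hY]
    fun_prop
  set C : Fin M → (Fin n → Fin 2 → ℝ) × (Fin n → ℝ) → Fin n → ℝ :=
    fun w t i => c.enc w t.1 i + t.1 i 0 + t.2 i with hC
  set D : (Fin n → Fin 2 → ℝ) × (Fin n → ℝ) → Fin n → ℝ :=
    fun t i => t.1 i 0 - t.1 i 1 + 2 * t.2 i with hD
  have hDm : Measurable D := by simp only [hD]; fun_prop
  have hlaw : τ.map D = gaussianVec (Fin n) (Qd + 4 * α) := map_state_difference hd α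
  have hmp : ∀ k, MeasurePreserving
      (fun p : ((Fin n → Fin 2 → ℝ) × (Fin n → ℝ)) × (Fin n → ℝ) => (p.1.1, noise k p.1.2 p.2)) π
      (ν.prod (gaussianVec (Fin n) 1)) := fun k => by
    rw [← hαβ]
    exact measurePreserving_state_noise ν k
  have hY0 : ∀ w (p : ((Fin n → Fin 2 → ℝ) × (Fin n → ℝ)) × (Fin n → ℝ)),
      C w p.1 + p.2 = Y w 0 (p.1.1, noise 0 p.1.2 p.2) := fun w p => by
    ext i; simp only [hC, hY, noise_zero, Pi.add_apply]; ring
  have hY1 : ∀ w (p : ((Fin n → Fin 2 → ℝ) × (Fin n → ℝ)) × (Fin n → ℝ)),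
      C w p.1 + p.2 - D p.1 = Y w 1 (p.1.1, noise 1 p.1.2 p.2) := fun w p => by
    ext i; simp only [hC, hY, hD, noise_one, Pi.add_apply, Pi.sub_apply, Pi.neg_apply]; ring
  have hmom := fun k => c.integral_output_sq hM hn hP (hS k)
  have hAm : ∀ k w, MeasurableSet (c.dec k ⁻¹' {w}) := fun k w =>
    c.measurable_dec k (measurableSet_singleton w)
  have hYi : ∀ w k, Integrable (fun p : ((Fin n → Fin 2 → ℝ) × (Fin n → ℝ)) × (Fin n → ℝ) =>
      ∑ i, (Y w k (p.1.1, noise k p.1.2 p.2)) i ^ 2) π := fun w k =>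
    (hmp k).integrable_comp_of_integrable ((hmom k).1 w)
  have hYe : ∀ w k, ∫ p, ∑ i, (Y w k (p.1.1, noise k p.1.2 p.2)) i ^ 2 ∂π =
      ∫ p, ∑ i, (Y w k p) i ^ 2 ∂(ν.prod (gaussianVec (Fin n) 1)) := fun w k => by
    rw [← (hmp k).map_eq, integral_map (hmp k).aemeasurable]
    rw [(hmp k).map_eq]
    exact ((hmom k).1 w).aestronglyMeasurable
  set p : Fin M → ℝ := fun w => π.real {p : ((Fin n → Fin 2 → ℝ) × (Fin n → ℝ)) × (Fin n → ℝ) |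
    C w p.1 + p.2 ∈ c.dec 0 ⁻¹' {w} ∧
    C w p.1 + p.2 - D p.1 ∈ c.dec 1 ⁻¹' {w}} with hp
  have hstep : ∀ w l, l * p w ≤ Real.exp l * ((gaussianVec (Fin n) (V 0)).real (c.dec 0 ⁻¹' {w}) *
      (gaussianVec (Fin n) (V 1)).real (c.dec 1 ⁻¹' {w})) +
      (n / 2 * (Real.log (V 0) + Real.log (V 1) - Real.log ((Qd + 4 * α : ℝ≥0) : ℝ) -
        Real.log β - 2) +
      (∫ p, ∑ i, (Y w 0 p) i ^ 2 ∂(ν.prod (gaussianVec (Fin n) 1))) / (2 * V 0) +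
      (∫ p, ∑ i, (Y w 1 p) i ^ 2 ∂(ν.prod (gaussianVec (Fin n) 1))) / (2 * V 1)) := by
    intro w l
    have hCm : Measurable (C w) := hYm w 0
    have := mul_prob_decode_le hβ hδ hCm hDm hlaw (hV0 0) (hV0 1) (hAm 0 w) (hAm 1 w)
      (by simp only [hY0]; exact hYi w 0) (by simp only [hY1]; exact hYi w 1) l
    rw [← hYe w 0, ← hYe w 1]
    simp only [← hY0, ← hY1]
    rw [Fintype.card_fin] at this
    linarith
  have hpart : ∀ k, ∑ w, (gaussianVec (Fin n) (V k)).real (c.dec k ⁻¹' {w}) ≤ 1 := fun k => by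
    rw [← measureReal_biUnion_finset (fun w _ w' _ hne => Disjoint.preimage _ (by simpa using hne))
      fun w _ => hAm k w]
    exact measureReal_le_one
  have hfano := two_mul_log_card_le hM (fun w => measureReal_nonneg) (fun w => measureReal_nonneg)
    (hpart 0) (hpart 1) (fun w => measureReal_le_one) hstep
  have herr : ∑ w, (1 - p w) ≤ 2 * (M * (c.errorProb μS μZ).toReal) := by
    have h1 : ∀ w, 1 - p w ≤ ∑ k, (ν.prod (gaussianVec (Fin n) 1)).real
        {q | c.dec k (Y w k q) ≠ w} := by
      intro w
      have hmset : ∀ k, MeasurableSet {q | c.dec k (Y w k q) ≠ w} := fun k =>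
        ((c.measurable_dec k).comp (hYm w k)) (measurableSet_singleton w).compl
      rw [Fin.sum_univ_two, ← (hmp 0).measureReal_preimage (hmset 0).nullMeasurableSet,
        ← (hmp 1).measureReal_preimage (hmset 1).nullMeasurableSet]
      have hu : 1 ≤ π.real (((fun p : ((Fin n → Fin 2 → ℝ) × (Fin n → ℝ)) × (Fin n → ℝ) =>
          (p.1.1, noise 0 p.1.2 p.2)) ⁻¹' {q | c.dec 0 (Y w 0 q) ≠ w} ∪
          (fun p : ((Fin n → Fin 2 → ℝ) × (Fin n → ℝ)) × (Fin n → ℝ) =>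
          (p.1.1, noise 1 p.1.2 p.2)) ⁻¹' {q | c.dec 1 (Y w 1 q) ≠ w}) ∪
          {p | C w p.1 + p.2 ∈ c.dec 0 ⁻¹' {w} ∧ C w p.1 + p.2 - D p.1 ∈ c.dec 1 ⁻¹' {w}}) := by
        refine le_trans (le_of_eq probReal_univ.symm) (measureReal_mono fun q _ => ?_)
        simp only [hY1]
        simp only [hY0, Set.mem_union, Set.mem_preimage, Set.mem_ofPred_eq, Set.mem_singleton_iff]
        tauto
      have h2 := measureReal_union_le (μ := π)
        ((fun p : ((Fin n → Fin 2 → ℝ) × (Fin n → ℝ)) × (Fin n → ℝ) =>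
          (p.1.1, noise 0 p.1.2 p.2)) ⁻¹' {q | c.dec 0 (Y w 0 q) ≠ w})
        ((fun p : ((Fin n → Fin 2 → ℝ) × (Fin n → ℝ)) × (Fin n → ℝ) =>
          (p.1.1, noise 1 p.1.2 p.2)) ⁻¹' {q | c.dec 1 (Y w 1 q) ≠ w})
      have h3 := hu.trans (measureReal_union_le _ _)
      simp only [hp]
      linarith
    refine (Finset.sum_le_sum fun w _ => h1 w).trans ?_
    rw [Finset.sum_comm, Fin.sum_univ_two, two_mul]
    exact add_le_add (c.sum_prob_decode_ne_le (hZ 0)) (c.sum_prob_decode_ne_le (hZ 1))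
  have hlog : 0 ≤ Real.log (2 * M) := Real.log_nonneg (by
    have : (1 : ℝ) ≤ M := by exact_mod_cast hM
    linarith)
  -- Summed over both receivers this is at most `M * n`, which the `-2` in `hstep` removes.
  have hdiv : ∀ k, (∑ w, ∫ p, ∑ i, (Y w k p) i ^ 2 ∂(ν.prod (gaussianVec (Fin n) 1))) /
      (2 * V k) ≤ M * (n / 2) := fun k => by
    rw [div_le_iff₀ (by linarith [hVpos k]), hVc k]
    exact (hmom k).2.trans (le_of_eq (by ring))
  rw [Finset.sum_add_distrib, Finset.sum_add_distrib, ← Finset.sum_div, ← Finset.sum_div] at hfano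
  simp only [Finset.sum_const, Finset.card_univ, Fintype.card_fin, nsmul_eq_mul] at hfano
  have herr' := mul_le_mul_of_nonneg_left herr (mul_nonneg zero_le_two hlog)
  have h0 := hdiv 0
  have h1 := hdiv 1
  refine le_of_mul_le_mul_left ?_ hM'
  simp only [← hVc, Fin.sum_univ_two]
  linarith

end Code

/-! ### Optimal coupling and the limit of large block length. -/

/-- The noise coupling that is best for the converse, with `4 * log 2 * T Qd` as the resulting
log-determinant. -/
lemma exists_noise_parameters (Qd : ℝ≥0) : ∃ α β : ℝ≥0, α + β = 1 ∧ β ≠ 0 ∧ Qd + 4 * α ≠ 0 ∧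
    Real.log ((Qd + 4 * α : ℝ≥0) : ℝ) + Real.log β = 4 * Real.log 2 * T Qd := by
  have hL : Real.log 2 ≠ 0 := (Real.log_pos one_lt_two).ne'
  by_cases h : (4 : ℝ) < Qd
  · refine ⟨0, 1, by simp, one_ne_zero, ?_, ?_⟩
    · rw [mul_zero, add_zero]
      rintro rfl
      norm_num at h
    · rw [T, if_pos h, Real.logb]
      simp only [mul_zero, add_zero, NNReal.coe_one, Real.log_one]
      field_simp
  · have h' : (Qd : ℝ) ≤ 4 := not_lt.1 h
    have hα : ((Real.toNNReal ((4 - Qd) / 8) : ℝ≥0) : ℝ) = (4 - Qd) / 8 :=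
      Real.coe_toNNReal _ (by linarith)
    have hQ : (0 : ℝ) ≤ Qd := Qd.2
    -- The stationary point of `(Qd + 4α)(1 - α)`; it is negative for `Qd > 4`, where the maximum
    -- over `α ≥ 0` moves to `α = 0`.
    refine ⟨Real.toNNReal ((4 - Qd) / 8), (4 + Qd) / 8, ?_, ?_, ?_, ?_⟩
    · apply NNReal.coe_injective
      push_cast [hα]
      ring
    · positivity
    · rw [← NNReal.coe_ne_zero]
      push_cast [hα]
      linarith
    · rw [T, if_neg h, Real.logb, ← Real.log_mul]
      · push_cast [hα]
        rw [show ((Qd : ℝ) + 4 * ((4 - Qd) / 8)) * ((4 + Qd) / 8) = (1 + Qd / 4) ^ 2 by ring,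
          Real.log_pow]
        push_cast
        field_simp
        ring
      · push_cast [hα]
        linarith
      · positivity

/-- A rate is bounded by the leading coefficient of a Fano-type bound on the number of messages. -/
lemma rate_le_of_log_card_le {R K A : ℝ} (hR : 0 ≤ R) {ε : ℕ → ℝ} (hε0 : ∀ n, 0 ≤ ε n)
    (hε : Tendsto ε atTop (𝓝 0))
    (h : ∀ n : ℕ, 0 < n → 2 * Real.log ⌊(2 : ℝ) ^ ((n : ℝ) * R)⌋₊ -
      4 * Real.log (2 * ⌊(2 : ℝ) ^ ((n : ℝ) * R)⌋₊) * ε n ≤ A + n / 2 * K) :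
    4 * Real.log 2 * R ≤ K := by
  have hL : 0 < Real.log 2 := Real.log_pos one_lt_two
  have hinv : Tendsto (fun n : ℕ => (n : ℝ)⁻¹) atTop (𝓝 0) := tendsto_inv_atTop_nhds_zero_nat
  have hlim : Tendsto (fun n : ℕ => 2 * ((R - (n : ℝ)⁻¹) * Real.log 2) -
      4 * ((R + (n : ℝ)⁻¹) * Real.log 2) * ε n - A * (n : ℝ)⁻¹) atTop
      (𝓝 (2 * ((R - 0) * Real.log 2) - 4 * ((R + 0) * Real.log 2) * 0 - A * 0)) :=
    ((((hinv.const_sub R).mul_const _).const_mul 2).sub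
      ((((hinv.const_add R).mul_const _).const_mul 4).mul hε)).sub (hinv.const_mul A)
  have hle := le_of_tendsto hlim (b := K / 2) ?_
  · linarith
  filter_upwards [eventually_gt_atTop 0] with n hn
  have hn' : (0 : ℝ) < n := by exact_mod_cast hn
  set x : ℝ := (2 : ℝ) ^ ((n : ℝ) * R) with hx
  have hx1 : 1 ≤ x := Real.one_le_rpow one_le_two (by positivity)
  have hlogx : Real.log x = n * R * Real.log 2 := Real.log_rpow two_pos _
  have hM1 : (1 : ℝ) ≤ ⌊x⌋₊ := Nat.one_le_cast.2 (Nat.floor_pos.2 hx1)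
  -- Since `⌊x⌋₊ ≥ 1`, rounding down loses at most a factor 2.
  have hlow : n * R * Real.log 2 - Real.log 2 ≤ Real.log ⌊x⌋₊ := by
    rw [← hlogx, ← Real.log_div (by positivity) two_ne_zero]
    refine Real.log_le_log (by positivity) ?_
    have := Nat.lt_floor_add_one x
    linarith
  have hup : Real.log (2 * ⌊x⌋₊) ≤ n * R * Real.log 2 + Real.log 2 := by
    rw [← hlogx, Real.log_mul two_ne_zero (by positivity), add_comm]
    have := Real.log_le_log (by positivity) (Nat.floor_le (zero_le_one.trans hx1))
    linarith
  have hb := h n hn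
  have hm := mul_le_mul_of_nonneg_right hup (hε0 n)
  have e : 2 * ((R - (n : ℝ)⁻¹) * Real.log 2) - 4 * ((R + (n : ℝ)⁻¹) * Real.log 2) * ε n -
      A * (n : ℝ)⁻¹ = (2 * (n * R * Real.log 2 - Real.log 2) -
        4 * ((n * R * Real.log 2 + Real.log 2) * ε n) - A) / n := by
    field_simp
  rw [e, div_le_iff₀ hn']
  linarith

end Multicast

theorem theorem5
    (P : ℝ≥0) (Q : Fin 2 → ℝ≥0) (Qd : ℝ≥0)
    -- letter law of the interferences `(S₁, S₂)`: jointly Gaussian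
    (μS : Measure (Fin 2 → ℝ)) [IsGaussian μS]
    (hS : ∀ k, μS.map (fun s => s k) = gaussianReal 0 (Q k))
    (hd : μS.map (fun s => s 0 - s 1) = gaussianReal 0 Qd)
    -- letter law of the noises `(Z₁, Z₂)`: standard normal, coupled in any way (e.g. `Z₁ = Z₂`)
    (μZ : Measure (Fin 2 → ℝ)) [IsProbabilityMeasure μZ]
    (hZ : ∀ k, μZ.map (fun z => z k) = gaussianReal 0 1)
    (R : ℝ) (hR : Multicast.Achievable P μS μZ R) :
    R ≤ (∑ k, 1 / 4 * Real.logb 2 ((P : ℝ) + Q k + 1 + 2 * √((P : ℝ) * Q k))) -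
      Multicast.T Qd := by
  obtain ⟨hR0, c, hpow, herr⟩ := hR
  obtain ⟨α, β, hαβ, hβ, hδ, hT⟩ := Multicast.exists_noise_parameters Qd
  have hL : 0 < Real.log 2 := Real.log_pos one_lt_two
  have hε := (ENNReal.tendsto_toReal ENNReal.zero_ne_top).comp herr
  rw [ENNReal.toReal_zero] at hε
  have hrate := Multicast.rate_le_of_log_card_le hR0 (fun n => ENNReal.toReal_nonneg) hε
    fun n hn => (c n).converse_inequality (Nat.floor_pos.2 (Real.one_le_rpow one_le_two
      (by positivity))) hn hS hd hZ (hpow n) hαβ hβ hδ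
  rw [sub_sub, hT] at hrate
  have hsum : ∑ k, 1 / 4 * Real.logb 2 ((P : ℝ) + Q k + 1 + 2 * √((P : ℝ) * Q k)) =
      (∑ k, Real.log ((P : ℝ) + Q k + 1 + 2 * √((P : ℝ) * Q k))) / (4 * Real.log 2) := by
    rw [Finset.sum_div]
    refine Finset.sum_congr rfl fun k _ => ?_
    rw [Real.logb]
    field_simp
  rw [hsum, le_sub_iff_add_le, le_div_iff₀ (by positivity)]
  linarith
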